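/- \textbf{Setting.} Fix a set of constants $c$ and a set of meta variables $v$. \emph{Suspension expressions} are the terms $t$, environments $e$ and environment terms $(t,l)$ generated by $$t ::= c \mid v \mid \#i \mid (t\ t) \mid (\lambda\, t) \mid [\![t,n,n,e]\!],\qquad e ::= nil \mid (t,l)::e \mid \{\!\{e,n,n,e\}\!\},$$ with $i\ge 1$ and $n,l\ge 0$. Write $a\dot- b=\max(a-b,0)$. Put $len(nil)=0$, $len((t,n)::e)=1+len(e)$, $len(\{\!\{e_1,nl_1,ol_2,e_2\}\!\})=len(e_1)+(ol_2\dot- nl_1)$, and $lev(nil)=0$, $lev((t,n)::e)=n$, $lev(\{\!\{e_1,nl_1,ol_2,e_2\}\!\})=lev(e_2)+(nl_1\dot- ol_2)$. An expression is \emph{well-formed} if $len(e)=ol$ and $lev(e)\le nl$ for every subexpression $[\![t,ol,nl,e]\!]$, $len(e_2)=ol_2$ and $lev(e_1)\le nl_1$ for every subexpression $\{\!\{e_1,nl_1,ol_2,e_2\}\!\}$, and $lev(e)\le n$ for every subexpression $(t,n)::e$. The rewrite rules are \begin{itemize} \item $(\beta_s)$ $((\lambda\,t_1)\ t_2)\to[\![t_1,1,0,(t_2,0)::nil]\!]$;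 \item (r1) $[\![c,ol,nl,e]\!]\to c$; \item (r2) $[\![\#i,0,nl,nil]\!]\to\#(i+nl)$; \item (r3) $[\![\#1,ol,nl,(t,l)::e]\!]\to[\![t,0,nl-l,nil]\!]$; \item (r4) $[\![\#i,ol,nl,(t,l)::e]\!]\to[\![\#(i-1),ol-1,nl,e]\!]$ if $i>1$; \item (r5) $[\![(t_1\ t_2),ol,nl,e]\!]\to([\![t_1,ol,nl,e]\!]\ [\![t_2,ol,nl,e]\!])$; \item (r6) $[\![(\lambda\,t),ol,nl,e]\!]\to(\lambda\,[\![t,ol+1,nl+1,(\#1,nl+1)::e]\!])$; \item (r7) $[\![v,ol,nl,e]\!]\to v$ for meta variables $v$, present only under the \emph{logical} interpretation of meta variables and absent under the \emph{graftable} one; \item (m1) $[\![[\![t,ol_1,nl_1,e_1]\!],ol_2,nl_2,e_2]\!]\to[\![t,\,ol_1+(ol_2\dot- nl_1),\,nl_2+(nl_1\dot- ol_2),\,\{\!\{e_1,nl_1,ol_2,e_2\}\!\}]\!]$; \item (m2) $\{\!\{e_1,nl_1,0,nil\}\!\}\to e_1$; \item (m3) $\{\!\{nil,0,ol_2,e_2\}\!\}\to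 e_2$; \item (m4) $\{\!\{nil,nl_1,ol_2,(t,l)::e_2\}\!\}\to\{\!\{nil,nl_1-1,ol_2-1,e_2\}\!\}$ if $nl_1\ge1$; \item (m5) $\{\!\{(t,n)::e_1,nl_1,ol_2,(s,l)::e_2\}\!\}\to\{\!\{(t,n)::e_1,nl_1-1,ol_2-1,e_2\}\!\}$ if $nl_1>n$; \item (m6) $\{\!\{(t,n)::e_1,n,ol_2,(s,l)::e_2\}\!\}\to([\![t,ol_2,l,(s,l)::e_2]\!],\,l+(n\dot- ol_2))::\{\!\{e_1,n,ol_2,(s,l)::e_2\}\!\}$. \end{itemize} Let $\rhd_{\beta_s}$ be the relation of rewriting one subexpression by $(\beta_s)$, and $\rhd_{rm}$ that of rewriting one subexpression by a reading rule (r$\cdot$) or a merging rule (m$\cdot$). Write $|x|$ for the $\rhd_{rm}$-normal form of $x$. \emph{De Bruijn terms} are the terms without suspensions. For such terms put $S(c;s_1,\dots)=c$, $S(v;s_1,\dots)=v$, $S(\#i;s_1,s_2,\dots)=s_i$, $S((t\ u);s_1,\dots)=(S(t;s_1,\dots)\ S(u;s_1,\dots))$, $S((\lambda\,t);s_1,s_2,\dots)=(\lambda\,S(t;\#1,s_1',s_2',\dots))$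 with $s_i'=S(s_i;\#2,\#3,\dots)$. The relation $\rhd_\beta$ replaces one subterm $((\lambda\,t_1)\ t_2)$, with $t_1,t_2$ de Bruijn terms, by $S(t_1;t_2,\#1,\#2,\dots)$; it is also applied to such redexes inside environments and environment terms. $\rhd_\beta^*$ is its reflexive and transitive closure. \textbf{Theorem.} Let $x_1$ and $x_2$ be suspension expressions (terms, environments or environment terms) with $x_1$ well-formed and $x_1\rhd_{\beta_s}x_2$. Assume that meta variables are interpreted logically, or that no meta variable occurs in $x_1$. Then $x_1$ and $x_2$ have unique $\rhd_{rm}$-normal forms $|x_1|$ and $|x_2|$, and $|x_1|\rhd_\beta^*|x_2|$. -/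

import Mathlib

/-! ### De Bruijn terms, simultaneous substitution -/

/-- De Bruijn terms `c | v | #i | (t t) | (λ t)` over constants `C` and meta variables `V`.
Indices are positive.  Meta-variable-free terms are the usual de Bruijn terms. -/
inductive DBTerm (C V : Type*) where
  | const (c : C) : DBTerm C V
  | mvar (v : V) : DBTerm C V
  | var (i : ℕ+) : DBTerm C V
  | app (t₁ t₂ : DBTerm C V) : DBTerm C V
  | lam (t : DBTerm C V) : DBTerm C V

namespace DBTerm

variable {C V : Type*}

/-- Extension of a renaming to the scope of one more abstraction: `#1` is fixed. -/
def liftRen (ρ : ℕ+ → ℕ+) : ℕ+ → ℕ+ :=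
  fun i => if i = 1 then 1 else ρ (i - 1) + 1

/-- Renaming of the free indices. -/
def rename : (ℕ+ → ℕ+) → DBTerm C V → DBTerm C V
  | _, const c => const c
  | _, mvar v => mvar v
  | ρ, var i => var (ρ i)
  | ρ, app t₁ t₂ => app (rename ρ t₁) (rename ρ t₂)
  | ρ, lam t => lam (rename (liftRen ρ) t)

/-- The infinite sequence `t, s₁, s₂, s₃, …`. -/
def consSeq (t : DBTerm C V) (s : ℕ+ → DBTerm C V) : ℕ+ → DBTerm C V :=
  fun i => if i = 1 then t else s (i - 1)

/-- Simultaneous substitution `S(t; s₁, s₂, s₃, …)`.  Under an abstraction the sequence becomes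
`#1, s₁', s₂', …` with `sᵢ' = S(sᵢ; #2, #3, …)`; the latter is written as a renaming to make the
recursion structural, see `subst_lam` for the equation in terms of `subst` alone. -/
def subst : DBTerm C V → (ℕ+ → DBTerm C V) → DBTerm C V
  | const c, _ => const c
  | mvar v, _ => mvar v
  | var i, s => s i
  | app t₁ t₂, s => app (subst t₁ s) (subst t₂ s)
  | lam t, s => lam (subst t (consSeq (var 1) fun i => rename (· + 1) (s i)))

theorem consSeq_liftRen (ρ : ℕ+ → ℕ+) :
    consSeq (var 1 : DBTerm C V) (fun i => rename (· + 1) (var (ρ i))) =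
      fun i => var (liftRen ρ i) := by
  funext i
  by_cases h : i = 1 <;> simp [consSeq, liftRen, rename, h]

theorem rename_eq_subst (t : DBTerm C V) :
    ∀ ρ : ℕ+ → ℕ+, rename ρ t = subst t (fun i => var (ρ i)) := by
  induction t with
  | const c => intro ρ; rfl
  | mvar v => intro ρ; rfl
  | var i => intro ρ; rfl
  | app t₁ t₂ h₁ h₂ => intro ρ; simp only [rename, subst, h₁, h₂]
  | lam t h => intro ρ; simp only [rename, subst, h, ← consSeq_liftRen]

/-- `S((λ t); s₁, s₂, …) = λ S(t; #1, s₁', s₂', …)` where `sᵢ' = S(sᵢ; #2, #3, …)`. -/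
theorem subst_lam (t : DBTerm C V) (s : ℕ+ → DBTerm C V) :
    subst (lam t) s =
      lam (subst t (consSeq (var 1) fun i => subst (s i) fun k => var (k + 1))) := by
  simp only [subst, rename_eq_subst]

end DBTerm

/-! ### Suspension expressions -/

/-- The three syntactic categories: terms, environments, environment terms. -/
inductive SuspSort where
  | term
  | env
  | envTerm

/-- Pre-syntax of suspension expressions over constants `C` and meta variables `V`:
* terms `t ::= c | v | #i | (t t) | (λ t) | ⟦t, ol, nl, e⟧`;
* environments `e ::= nil | (t, l) :: e | ⦃e₁, nl₁, ol₂, e₂⦄`;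
* environment terms `(t, l)`. -/
inductive SuspExp (C V : Type*) : SuspSort → Type _ where
  | const (c : C) : SuspExp C V .term
  | mvar (v : V) : SuspExp C V .term
  | var (i : ℕ+) : SuspExp C V .term
  | app (t₁ t₂ : SuspExp C V .term) : SuspExp C V .term
  | lam (t : SuspExp C V .term) : SuspExp C V .term
  | susp (t : SuspExp C V .term) (ol nl : ℕ) (e : SuspExp C V .env) : SuspExp C V .term
  | nil : SuspExp C V .env
  | cons (a : SuspExp C V .envTerm) (e : SuspExp C V .env) : SuspExp C V .env
  | merge (e₁ : SuspExp C V .env) (nl₁ ol₂ : ℕ) (e₂ : SuspExp C V .env) : SuspExp C V .env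
  | pair (t : SuspExp C V .term) (l : ℕ) : SuspExp C V .envTerm

namespace SuspExp

variable {C V : Type*}

/-- Length of an environment (only meaningful for environments; `0` otherwise). -/
def len : {s : SuspSort} → SuspExp C V s → ℕ
  | _, cons _ e => 1 + len e
  | _, merge e₁ nl₁ ol₂ _ => len e₁ + (ol₂ - nl₁)
  | _, _ => 0

/-- Level of an environment or environment term (`0` for terms, where it is never used). -/
def lev : {s : SuspSort} → SuspExp C V s → ℕ
  | _, pair _ l => l
  | _, cons a _ => lev a
  | _, merge _ nl₁ ol₂ e₂ => lev e₂ + (nl₁ - ol₂)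
  | _, _ => 0

/-- Well-formedness; the constraints are imposed on every subexpression. -/
def WF : {s : SuspSort} → SuspExp C V s → Prop
  | _, const _ => True
  | _, mvar _ => True
  | _, var _ => True
  | _, app t₁ t₂ => WF t₁ ∧ WF t₂
  | _, lam t => WF t
  | _, susp t ol nl e => WF t ∧ WF e ∧ len e = ol ∧ lev e ≤ nl
  | _, nil => True
  | _, cons a e => WF a ∧ WF e ∧ lev e ≤ lev a
  | _, merge e₁ nl₁ ol₂ e₂ => WF e₁ ∧ WF e₂ ∧ len e₂ = ol₂ ∧ lev e₁ ≤ nl₁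
  | _, pair t _ => WF t

/-- No meta variable occurs in the expression. -/
def MetaFree : {s : SuspSort} → SuspExp C V s → Prop
  | _, const _ => True
  | _, mvar _ => False
  | _, var _ => True
  | _, app t₁ t₂ => MetaFree t₁ ∧ MetaFree t₂
  | _, lam t => MetaFree t
  | _, susp t _ _ e => MetaFree t ∧ MetaFree e
  | _, nil => True
  | _, cons a e => MetaFree a ∧ MetaFree e
  | _, merge e₁ _ _ e₂ => MetaFree e₁ ∧ MetaFree e₂
  | _, pair t _ => MetaFree t

/-- De Bruijn terms are terms of the suspension calculus. -/
def ofDB : DBTerm C V → SuspExp C V .term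
  | .const c => const c
  | .mvar v => mvar v
  | .var i => var i
  | .app t₁ t₂ => app (ofDB t₁) (ofDB t₂)
  | .lam t => lam (ofDB t)

end SuspExp

/-! ### Rewrite rules and rewrite relations -/

/-- The two interpretations of meta variables: under the logical one a suspension over a meta
variable is dropped by an additional reading rule, under the graftable one it is not. -/
inductive MetaInterp where
  | graftable
  | logical

section Rules

open SuspExp

variable {C V : Type*}

/-- The rule `β_s`. -/
inductive BetaSRule : ⦃s : SuspSort⦄ → SuspExp C V s → SuspExp C V s → Prop where
  | betaS (t₁ t₂ : SuspExp C V .term) :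
      BetaSRule (app (lam t₁) t₂) (susp t₁ 1 0 (cons (pair t₂ 0) nil))

/-- The reading rules; `r7` is present only under the logical interpretation. -/
inductive ReadRule (μ : MetaInterp) :
    ⦃s : SuspSort⦄ → SuspExp C V s → SuspExp C V s → Prop where
  | r1 (c : C) (ol nl : ℕ) (e : SuspExp C V .env) :
      ReadRule μ (susp (const c) ol nl e) (const c)
  | r2 (i j : ℕ+) (nl : ℕ) (hj : (j : ℕ) = i + nl) :
      ReadRule μ (susp (var i) 0 nl nil) (var j)
  | r3 (ol nl : ℕ) (t : SuspExp C V .term) (l : ℕ) (e : SuspExp C V .env) :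
      ReadRule μ (susp (var 1) ol nl (cons (pair t l) e)) (susp t 0 (nl - l) nil)
  | r4 (i : ℕ+) (ol nl : ℕ) (t : SuspExp C V .term) (l : ℕ) (e : SuspExp C V .env)
      (hi : 1 < i) :
      ReadRule μ (susp (var i) ol nl (cons (pair t l) e)) (susp (var (i - 1)) (ol - 1) nl e)
  | r5 (t₁ t₂ : SuspExp C V .term) (ol nl : ℕ) (e : SuspExp C V .env) :
      ReadRule μ (susp (app t₁ t₂) ol nl e) (app (susp t₁ ol nl e) (susp t₂ ol nl e))
  | r6 (t : SuspExp C V .term) (ol nl : ℕ) (e : SuspExp C V .env) :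
      ReadRule μ (susp (lam t) ol nl e)
        (lam (susp t (ol + 1) (nl + 1) (cons (pair (var 1) (nl + 1)) e)))
  | r7 (hμ : μ = .logical) (v : V) (ol nl : ℕ) (e : SuspExp C V .env) :
      ReadRule μ (susp (mvar v) ol nl e) (mvar v)

/-- The merging rules (subtraction of naturals is truncated). -/
inductive MergeRule : ⦃s : SuspSort⦄ → SuspExp C V s → SuspExp C V s → Prop where
  | m1 (t : SuspExp C V .term) (ol₁ nl₁ : ℕ) (e₁ : SuspExp C V .env)
      (ol₂ nl₂ : ℕ) (e₂ : SuspExp C V .env) :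
      MergeRule (susp (susp t ol₁ nl₁ e₁) ol₂ nl₂ e₂)
        (susp t (ol₁ + (ol₂ - nl₁)) (nl₂ + (nl₁ - ol₂)) (merge e₁ nl₁ ol₂ e₂))
  | m2 (e₁ : SuspExp C V .env) (nl₁ : ℕ) :
      MergeRule (merge e₁ nl₁ 0 nil) e₁
  | m3 (ol₂ : ℕ) (e₂ : SuspExp C V .env) :
      MergeRule (merge nil 0 ol₂ e₂) e₂
  | m4 (nl₁ ol₂ : ℕ) (t : SuspExp C V .term) (l : ℕ) (e₂ : SuspExp C V .env)
      (h : 1 ≤ nl₁) :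
      MergeRule (merge nil nl₁ ol₂ (cons (pair t l) e₂)) (merge nil (nl₁ - 1) (ol₂ - 1) e₂)
  | m5 (t : SuspExp C V .term) (n : ℕ) (e₁ : SuspExp C V .env) (nl₁ ol₂ : ℕ)
      (u : SuspExp C V .term) (l : ℕ) (e₂ : SuspExp C V .env) (h : n < nl₁) :
      MergeRule (merge (cons (pair t n) e₁) nl₁ ol₂ (cons (pair u l) e₂))
        (merge (cons (pair t n) e₁) (nl₁ - 1) (ol₂ - 1) e₂)
  | m6 (t : SuspExp C V .term) (n : ℕ) (e₁ : SuspExp C V .env) (ol₂ : ℕ)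
      (u : SuspExp C V .term) (l : ℕ) (e₂ : SuspExp C V .env) :
      MergeRule (merge (cons (pair t n) e₁) n ol₂ (cons (pair u l) e₂))
        (cons (pair (susp t ol₂ l (cons (pair u l) e₂)) (l + (n - ol₂)))
          (merge e₁ n ol₂ (cons (pair u l) e₂)))

/-- De Bruijn `β`-contraction at the root: `((λ t₁) t₂)` becomes `S(t₁; t₂, #1, #2, …)`, where
`t₁` and `t₂` are de Bruijn terms. -/
inductive BetaRule : ⦃s : SuspSort⦄ → SuspExp C V s → SuspExp C V s → Prop where
  | beta (t₁ t₂ : DBTerm C V) :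
      BetaRule (app (lam (ofDB t₁)) (ofDB t₂))
        (ofDB (t₁.subst (DBTerm.consSeq t₂ DBTerm.var)))

/-- The rewrite relation generated by a set of rules: exactly one subexpression is replaced. -/
inductive Rewrite (R : ⦃s : SuspSort⦄ → SuspExp C V s → SuspExp C V s → Prop) :
    {s : SuspSort} → SuspExp C V s → SuspExp C V s → Prop where
  | root {s : SuspSort} {x y : SuspExp C V s} (h : R x y) : Rewrite R x y
  | appL {t₁ t₁' : SuspExp C V .term} (t₂ : SuspExp C V .term) (h : Rewrite R t₁ t₁') :
      Rewrite R (app t₁ t₂) (app t₁' t₂)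
  | appR (t₁ : SuspExp C V .term) {t₂ t₂' : SuspExp C V .term} (h : Rewrite R t₂ t₂') :
      Rewrite R (app t₁ t₂) (app t₁ t₂')
  | lam {t t' : SuspExp C V .term} (h : Rewrite R t t') :
      Rewrite R (lam t) (lam t')
  | suspL {t t' : SuspExp C V .term} (ol nl : ℕ) (e : SuspExp C V .env)
      (h : Rewrite R t t') : Rewrite R (susp t ol nl e) (susp t' ol nl e)
  | suspR (t : SuspExp C V .term) (ol nl : ℕ) {e e' : SuspExp C V .env}
      (h : Rewrite R e e') : Rewrite R (susp t ol nl e) (susp t ol nl e')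
  | consL {a a' : SuspExp C V .envTerm} (e : SuspExp C V .env) (h : Rewrite R a a') :
      Rewrite R (cons a e) (cons a' e)
  | consR (a : SuspExp C V .envTerm) {e e' : SuspExp C V .env} (h : Rewrite R e e') :
      Rewrite R (cons a e) (cons a e')
  | mergeL {e₁ e₁' : SuspExp C V .env} (nl₁ ol₂ : ℕ) (e₂ : SuspExp C V .env)
      (h : Rewrite R e₁ e₁') : Rewrite R (merge e₁ nl₁ ol₂ e₂) (merge e₁' nl₁ ol₂ e₂)
  | mergeR (e₁ : SuspExp C V .env) (nl₁ ol₂ : ℕ) {e₂ e₂' : SuspExp C V .env}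
      (h : Rewrite R e₂ e₂') : Rewrite R (merge e₁ nl₁ ol₂ e₂) (merge e₁ nl₁ ol₂ e₂')
  | pair {t t' : SuspExp C V .term} (l : ℕ) (h : Rewrite R t t') :
      Rewrite R (pair t l) (pair t' l)

variable {s : SuspSort}

/-- `x ▷_{β_s} y`. -/
def StepBetaS (x y : SuspExp C V s) : Prop := Rewrite BetaSRule x y

/-- `x ▷_r y`. -/
def StepR (μ : MetaInterp) (x y : SuspExp C V s) : Prop := Rewrite (ReadRule μ) x y

/-- `x ▷_m y`. -/
def StepM (x y : SuspExp C V s) : Prop := Rewrite MergeRule x y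

/-- `x ▷_{rm} y`. -/
def StepRM (μ : MetaInterp) (x y : SuspExp C V s) : Prop := StepR μ x y ∨ StepM x y

/-- `x ▷_β y`: a `β`-redex formed by de Bruijn terms is contracted.  On de Bruijn terms this is
de Bruijn `β`-contraction; on simple environments of de Bruijn terms one component is contracted. -/
def StepBeta (x y : SuspExp C V s) : Prop := Rewrite BetaRule x y

/-- `y` is obtained from `x` by `▷_{rm}`-steps and admits no further `▷_{rm}`-step. -/
def IsRMNormalForm (μ : MetaInterp) (x y : SuspExp C V s) : Prop :=
  Relation.ReflTransGen (StepRM μ) x y ∧ ∀ z, ¬ StepRM μ y z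

/-- `|x| = y`: the expression `y` is the one and only `▷_{rm}`-normal form of `x`. -/
def IsTheRMNormalForm (μ : MetaInterp) (x y : SuspExp C V s) : Prop :=
  IsRMNormalForm μ x y ∧ ∀ z, IsRMNormalForm μ x z → z = y

end Rules

/-! The proof gives every expression a value: a suspension denotes a simultaneous substitution into
a de Bruijn term, a merge denotes an explicitly computed list of pairs (term, level), and all other
constructors denote themselves (`denote`).

Three facts identify this value with the `▷_{rm}`-normal form. A well-formed expression reduces to
its value (`rmStar_embed_denote`); reading and merging steps leave the value unchanged
(`denote_stepRM`); values are irreducible (`not_stepRM_embed`). Existence and uniqueness follow,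
with neither termination nor confluence proved separately. The heart of invariance is
`envSeq_mergeEnv`: merging environments composes the substitutions they represent, which is the
content of m1. The condition on meta variables ensures that a suspension over a meta variable can be
discharged by r7.

For a `β_s`-step, the contractum denotes the `β`-contractum of the value of the redex. All
constructors act monotonically on values with respect to `▷_β^*`, because substitution and merging
respect `β` (`BetaStar.subst`, `BetaEnv.mergeEnv`); see `denote_stepBetaS`. Several steps, or none,
may be needed, since substitution copies and erases redexes. -/

namespace DBTerm

variable {C V : Type*}

/-! ### Substitution calculus on de Bruijn terms -/

/-- The index `i + n`. -/
def addNat (n : ℕ) (i : ℕ+) : ℕ+ := ⟨i + n, Nat.add_pos_left i.pos n⟩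

/-- The substitution used under an abstraction. -/
def up (s : ℕ+ → DBTerm C V) : ℕ+ → DBTerm C V :=
  consSeq (var 1) fun i => rename (· + 1) (s i)

/-- Raising all free indices by `n`. -/
def shift (n : ℕ) : DBTerm C V → DBTerm C V := rename (addNat n)

theorem pnat_cases (i : ℕ+) : i = 1 ∨ ∃ j : ℕ+, i = j + 1 := by
  induction i using PNat.recOn with
  | one => exact Or.inl rfl
  | succ j _ => exact Or.inr ⟨j, rfl⟩

theorem pnat_add_one_ne_one (j : ℕ+) : j + 1 ≠ 1 := by
  intro h
  have h' := congrArg PNat.val h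
  have := j.pos
  simp only [PNat.add_coe, PNat.one_coe] at h'
  omega

@[simp] theorem consSeq_one (t : DBTerm C V) (s) : consSeq t s 1 = t := if_pos rfl

@[simp] theorem consSeq_add_one (t : DBTerm C V) (s) (j : ℕ+) : consSeq t s (j + 1) = s j := by
  simp [consSeq, pnat_add_one_ne_one]

@[simp] theorem liftRen_one (ρ : ℕ+ → ℕ+) : liftRen ρ 1 = 1 := if_pos rfl

@[simp] theorem liftRen_add_one (ρ : ℕ+ → ℕ+) (j : ℕ+) : liftRen ρ (j + 1) = ρ j + 1 := by
  simp [liftRen, pnat_add_one_ne_one]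

theorem seq_ext {α : Type*} {s s' : ℕ+ → α} (h1 : s 1 = s' 1)
    (hs : ∀ j : ℕ+, s (j + 1) = s' (j + 1)) : s = s' := by
  funext i
  rcases pnat_cases i with rfl | ⟨j, rfl⟩
  exacts [h1, hs j]

theorem liftRen_comp (ρ ρ' : ℕ+ → ℕ+) : liftRen ρ ∘ liftRen ρ' = liftRen (ρ ∘ ρ') :=
  seq_ext (by simp) (by simp)

/-- Composition laws come in the order renaming-renaming, substitution-renaming,
renaming-substitution, substitution-substitution. `up` shifts the entries it carries, so the case of
an abstraction in the later laws relies on earlier ones. -/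
theorem rename_rename (t : DBTerm C V) :
    ∀ ρ ρ' : ℕ+ → ℕ+, rename ρ (rename ρ' t) = rename (ρ ∘ ρ') t := by
  induction t with
  | const c => intros; rfl
  | mvar v => intros; rfl
  | var i => intros; rfl
  | app t₁ t₂ h₁ h₂ => intros; simp only [rename, h₁, h₂]
  | lam t h => intros; simp only [rename, h, liftRen_comp]

theorem liftRen_id : liftRen id = id := seq_ext (by simp) (by simp)

theorem rename_id (t : DBTerm C V) : rename id t = t := by
  induction t with
  | const c => rfl
  | mvar v => rfl
  | var i => rfl
  | app t₁ t₂ h₁ h₂ => simp only [rename, h₁, h₂]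
  | lam t h => simp only [rename, h, liftRen_id]

theorem up_comp_liftRen (s : ℕ+ → DBTerm C V) (ρ : ℕ+ → ℕ+) :
    up s ∘ liftRen ρ = up (s ∘ ρ) :=
  seq_ext (by simp [up]) (by simp [up])

theorem subst_lam_up (t : DBTerm C V) (s) : subst (lam t) s = lam (subst t (up s)) := rfl

theorem subst_rename (t : DBTerm C V) :
    ∀ (ρ : ℕ+ → ℕ+) (s : ℕ+ → DBTerm C V), subst (rename ρ t) s = subst t (s ∘ ρ) := by
  induction t with
  | const c => intros; rfl
  | mvar v => intros; rfl
  | var i => intros; rfl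
  | app t₁ t₂ h₁ h₂ => intros; simp only [rename, subst, h₁, h₂]
  | lam t h => intros; simp only [rename, subst_lam_up, h, up_comp_liftRen]

theorem rename_up (s : ℕ+ → DBTerm C V) (ρ : ℕ+ → ℕ+) :
    (fun i => rename (liftRen ρ) (up s i)) = up fun i => rename ρ (s i) := by
  refine seq_ext (by simp [up, rename]) fun j => ?_
  simp only [up, consSeq_add_one, rename_rename]
  congr 1
  funext i
  simp

theorem rename_subst (t : DBTerm C V) :
    ∀ (ρ : ℕ+ → ℕ+) (s : ℕ+ → DBTerm C V),
      rename ρ (subst t s) = subst t fun i => rename ρ (s i) := by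
  induction t with
  | const c => intros; rfl
  | mvar v => intros; rfl
  | var i => intros; rfl
  | app t₁ t₂ h₁ h₂ => intros; simp only [rename, subst, h₁, h₂]
  | lam t h => intros; simp only [rename, subst_lam_up, h, rename_up]

theorem up_subst (s s' : ℕ+ → DBTerm C V) :
    (fun i => subst (up s i) (up s')) = up fun i => subst (s i) s' := by
  refine seq_ext (by simp [up, subst]) fun j => ?_
  simp only [up, consSeq_add_one, subst_rename, rename_subst]
  congr 1
  funext i
  simp

theorem subst_subst (t : DBTerm C V) :
    ∀ s s' : ℕ+ → DBTerm C V, subst (subst t s) s' = subst t fun i => subst (s i) s' := by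
  induction t with
  | const c => intros; rfl
  | mvar v => intros; rfl
  | var i => intros; rfl
  | app t₁ t₂ h₁ h₂ => intros; simp only [subst, h₁, h₂]
  | lam t h => intros; simp only [subst_lam_up, h, up_subst]

theorem up_var : up (var : ℕ+ → DBTerm C V) = var :=
  seq_ext (by simp [up]) (by simp [up, rename])

theorem subst_var (t : DBTerm C V) : subst t var = t := by
  induction t with
  | const c => rfl
  | mvar v => rfl
  | var i => rfl
  | app t₁ t₂ h₁ h₂ => simp only [subst, h₁, h₂]
  | lam t h => simp only [subst_lam_up, up_var, h]

@[simp] theorem addNat_zero : addNat 0 = id := by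
  funext i; exact PNat.eq (Nat.add_zero _)

theorem addNat_one : addNat 1 = (· + 1) := rfl

theorem addNat_succ (n : ℕ) (i : ℕ+) : addNat (n + 1) i = addNat n i + 1 := rfl

@[simp] theorem addNat_comp (m n : ℕ) : addNat m ∘ addNat n = addNat (n + m) := by
  funext i; exact PNat.eq (Nat.add_assoc _ _ _)

@[simp] theorem shift_zero (t : DBTerm C V) : shift 0 t = t := by
  rw [shift, addNat_zero, rename_id]

theorem shift_shift (m n : ℕ) (t : DBTerm C V) : shift m (shift n t) = shift (n + m) t := by
  rw [shift, shift, rename_rename, addNat_comp, shift]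

theorem shift_subst (n : ℕ) (t : DBTerm C V) (s) :
    shift n (subst t s) = subst t fun i => shift n (s i) := rename_subst _ _ _

/-! ### Simple environments -/

/-- The substitution represented by a simple environment at the new level `nl`. -/
def envSeq : List (DBTerm C V × ℕ) → ℕ → ℕ+ → DBTerm C V
  | [], nl => fun i => var (addNat nl i)
  | p :: e, nl => consSeq (shift (nl - p.2) p.1) (envSeq e nl)

theorem envSeq_singleton_zero (t : DBTerm C V) : envSeq [(t, 0)] 0 = consSeq t var := by
  simp only [envSeq, Nat.sub_zero, shift_zero, addNat_zero, id]

/-- The levels in the environment are weakly decreasing and bounded by the given number. -/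
def Desc : ℕ → List (DBTerm C V × ℕ) → Prop
  | _, [] => True
  | n, p :: e => p.2 ≤ n ∧ Desc p.2 e

theorem Desc.mono {m n : ℕ} (h : m ≤ n) : ∀ {e : List (DBTerm C V × ℕ)}, Desc m e → Desc n e
  | [], _ => trivial
  | _ :: _, he => ⟨he.1.trans h, he.2⟩

theorem Desc.le {n : ℕ} {e : List (DBTerm C V × ℕ)} (h : Desc n e) : ∀ p ∈ e, p.2 ≤ n := by
  induction e generalizing n with
  | nil => simp
  | cons q e ih =>
    intro p hp
    rcases List.mem_cons.1 hp with rfl | hp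
    exacts [h.1, (ih h.2 p hp).trans h.1]

/-- The level bound keeps the truncated difference `nl - p.2` exact, so it grows by exactly `k`. -/
theorem envSeq_add {nl : ℕ} {e : List (DBTerm C V × ℕ)} (h : ∀ p ∈ e, p.2 ≤ nl) (k : ℕ) :
    envSeq e (nl + k) = fun i => shift k (envSeq e nl i) := by
  induction e with
  | nil => funext i; exact congrArg var (congrFun (addNat_comp k nl) i).symm
  | cons p e ih =>
    have h1 := h p (by simp)
    refine seq_ext ?_ fun j => ?_
    · simp only [envSeq, consSeq_one, shift_shift]
      congr 1; omega
    · simp only [envSeq, consSeq_add_one]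
      rw [ih fun q hq => h q (by simp [hq])]

/-- This is the soundness of r6: the new entry `#1` has the current level and is not shifted, while
every old entry is shifted once more. -/
theorem envSeq_lift {nl : ℕ} {e : List (DBTerm C V × ℕ)} (h : ∀ p ∈ e, p.2 ≤ nl) :
    envSeq ((var 1, nl + 1) :: e) (nl + 1) = up (envSeq e nl) := by
  refine seq_ext (by simp [envSeq, up]) fun j => ?_
  simp only [envSeq, up, consSeq_add_one, envSeq_add h, shift, addNat_one]

/-- Merging of simple environments. -/
def mergeEnv (e₁ : List (DBTerm C V × ℕ)) (nl₁ : ℕ) :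
    List (DBTerm C V × ℕ) → List (DBTerm C V × ℕ)
  | [] => e₁
  | q :: e₂ =>
    match e₁ with
    | [] => if nl₁ = 0 then q :: e₂ else mergeEnv [] (nl₁ - 1) e₂
    | p :: e₁ =>
      if p.2 < nl₁ then mergeEnv (p :: e₁) (nl₁ - 1) e₂
      -- Rule m6 demands `p.2 = nl₁`; under `Desc nl₁` this is the only way to reach the branch.
      -- `e₂.length + 1` stands for the annotation `ol₂`.
      else (p.1.subst (envSeq (q :: e₂) q.2), q.2 + (p.2 - (e₂.length + 1))) ::
        mergeEnv e₁ p.2 (q :: e₂)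
  termination_by e₂ => (e₁.length, e₂.length)

theorem mergeEnv_nil_right (e₁ : List (DBTerm C V × ℕ)) (nl₁ : ℕ) : mergeEnv e₁ nl₁ [] = e₁ := by
  rw [mergeEnv]

theorem mergeEnv_nil_zero (e₂ : List (DBTerm C V × ℕ)) : mergeEnv [] 0 e₂ = e₂ := by
  cases e₂ <;> simp [mergeEnv]

theorem mergeEnv_nil_succ (n : ℕ) (q) (e₂ : List (DBTerm C V × ℕ)) :
    mergeEnv [] (n + 1) (q :: e₂) = mergeEnv [] n e₂ := by
  rw [mergeEnv]; simp

theorem mergeEnv_cons_succ (p) (e₁ : List (DBTerm C V × ℕ)) (n : ℕ) (q)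
    (e₂ : List (DBTerm C V × ℕ)) (h : p.2 ≤ n) :
    mergeEnv (p :: e₁) (n + 1) (q :: e₂) = mergeEnv (p :: e₁) n e₂ := by
  rw [mergeEnv]; simp [Nat.lt_succ_of_le h]

theorem mergeEnv_cons_self (p) (e₁ : List (DBTerm C V × ℕ)) (q)
    (e₂ : List (DBTerm C V × ℕ)) :
    mergeEnv (p :: e₁) p.2 (q :: e₂) =
      (p.1.subst (envSeq (q :: e₂) q.2), q.2 + (p.2 - (e₂.length + 1))) ::
        mergeEnv e₁ p.2 (q :: e₂) := by
  rw [mergeEnv]; simp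

/-- The substitution of a merged environment is the composition of the two substitutions. -/
theorem envSeq_mergeEnv (e₁ : List (DBTerm C V × ℕ)) (nl₁ : ℕ) (e₂ : List (DBTerm C V × ℕ)) :
    ∀ nl₂, Desc nl₁ e₁ → Desc nl₂ e₂ →
      envSeq (mergeEnv e₁ nl₁ e₂) (nl₂ + (nl₁ - e₂.length)) =
        fun i => (envSeq e₁ nl₁ i).subst (envSeq e₂ nl₂) := by
  induction e₁ generalizing nl₁ e₂ with
  | nil =>
    induction e₂ generalizing nl₁ with
    | nil =>
      intro nl₂ _ _
      funext i
      rw [mergeEnv_nil_right, List.length_nil, Nat.sub_zero, Nat.add_comm]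
      exact congrArg var (congrFun (addNat_comp nl₂ nl₁) i).symm
    | cons q e₂ ih =>
      intro nl₂ _ h₂
      rcases nl₁ with _ | n
      · rw [mergeEnv_nil_zero, Nat.zero_sub, Nat.add_zero]
        funext i
        simp [envSeq, subst]
      · rw [mergeEnv_nil_succ, List.length_cons, Nat.add_sub_add_right,
          ih n nl₂ trivial (h₂.2.mono h₂.1)]
        funext i
        simp [envSeq, subst, addNat_succ]
  | cons p e₁ ih₁ =>
    induction e₂ generalizing nl₁ with
    | nil =>
      intro nl₂ h₁ _
      rw [mergeEnv_nil_right, List.length_nil, Nat.sub_zero, Nat.add_comm, envSeq_add h₁.le]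
      funext i
      exact rename_eq_subst _ _
    | cons q e₂ ih =>
      intro nl₂ h₁ h₂
      rcases h₁.1.eq_or_lt with h | h
      · subst h
        rw [mergeEnv_cons_self]
        -- The merged head is computed at level `q.2`; reading it at the outer level shifts it by
        -- `nl₂ - q.2`, which amounts to using the second environment at level `nl₂` directly.
        have hs : envSeq (q :: e₂) nl₂ = fun i => shift (nl₂ - q.2) (envSeq (q :: e₂) q.2 i) := by
          have := envSeq_add (e := q :: e₂) (nl := q.2) (Desc.le ⟨le_rfl, h₂.2⟩) (nl₂ - q.2)
          rwa [Nat.add_sub_cancel' h₂.1] at this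
        refine seq_ext ?_ fun j => ?_
        · simp only [envSeq.eq_2 _ p, envSeq.eq_2 _ (subst _ _, _), consSeq_one, Nat.sub_self,
            shift_zero, shift_subst, List.length_cons, Nat.add_sub_add_right]
          rw [hs]
        · have := congrFun (ih₁ p.2 (q :: e₂) nl₂ h₁.2 h₂) j
          simpa only [envSeq.eq_2 _ p, envSeq.eq_2 _ (subst _ _, _), consSeq_add_one] using this
      · obtain ⟨n, rfl⟩ := Nat.exists_eq_succ_of_ne_zero (Nat.ne_of_gt (Nat.zero_lt_of_lt h))
        have hn : p.2 ≤ n := Nat.le_of_lt_succ h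
        have h₁' : Desc n (p :: e₁) := ⟨hn, h₁.2⟩
        -- All entries of the first environment lie at level at most `n`, so at level `n + 1` they
        -- are shifted by one and never refer to the head `q`, which may be dropped.
        rw [mergeEnv_cons_succ _ _ _ _ _ hn, List.length_cons, Nat.succ_sub_succ,
          ih n nl₂ h₁' (h₂.2.mono h₂.1), Nat.succ_eq_add_one, envSeq_add h₁'.le]
        funext i
        simp only [shift, subst_rename, addNat_one]
        congr 1
        funext j
        simp [envSeq]

/-! ### Compatibility of `β` with substitution -/

/-- One-step `β`-reduction of de Bruijn terms. -/
inductive Beta : DBTerm C V → DBTerm C V → Prop where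
  | beta (t₁ t₂ : DBTerm C V) : Beta (app (lam t₁) t₂) (t₁.subst (consSeq t₂ var))
  | appL {t₁ t₁' : DBTerm C V} (t₂ : DBTerm C V) : Beta t₁ t₁' → Beta (app t₁ t₂) (app t₁' t₂)
  | appR (t₁ : DBTerm C V) {t₂ t₂' : DBTerm C V} : Beta t₂ t₂' → Beta (app t₁ t₂) (app t₁ t₂')
  | lam {t t' : DBTerm C V} : Beta t t' → Beta (lam t) (lam t')

theorem beta_envSeq (t₁ t₂ : DBTerm C V) :
    Beta (app (lam t₁) t₂) (t₁.subst (envSeq [(t₂, 0)] 0)) := by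
  rw [envSeq_singleton_zero]
  exact Beta.beta t₁ t₂

/-- The reflexive and transitive closure of `Beta`. -/
abbrev BetaStar : DBTerm C V → DBTerm C V → Prop := Relation.ReflTransGen Beta

theorem BetaStar.app {t₁ t₁' t₂ t₂' : DBTerm C V} (h₁ : BetaStar t₁ t₁') (h₂ : BetaStar t₂ t₂') :
    BetaStar (app t₁ t₂) (app t₁' t₂') :=
  (h₁.lift (fun t => DBTerm.app t t₂) fun _ _ h => Beta.appL t₂ h).trans
    (h₂.lift (fun t => DBTerm.app t₁' t) fun _ _ h => Beta.appR t₁' h)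

theorem BetaStar.lam {t t' : DBTerm C V} (h : BetaStar t t') : BetaStar (lam t) (lam t') :=
  Relation.ReflTransGen.lift DBTerm.lam (fun _ _ => Beta.lam) _ _ h

/-- The substitution lemma in the form needed for a root contraction in `Beta.subst`. -/
theorem subst_consSeq_up (t₁ t₂ : DBTerm C V) (s : ℕ+ → DBTerm C V) :
    (t₁.subst (consSeq t₂ var)).subst s =
      (t₁.subst (up s)).subst (consSeq (t₂.subst s) var) := by
  rw [subst_subst, subst_subst]
  congr 1
  refine seq_ext (by simp [up, subst]) fun j => ?_
  simp only [up, consSeq_add_one, subst_rename, subst]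
  -- On the tail, discarding the head undoes the shift made by `up`; writing `s j` as an identity
  -- substitution makes the two sides comparable.
  conv_lhs => rw [← subst_var (s j)]
  congr 1
  funext i
  simp

theorem Beta.subst {t t' : DBTerm C V} (h : Beta t t') :
    ∀ s : ℕ+ → DBTerm C V, Beta (t.subst s) (t'.subst s) := by
  induction h with
  | beta t₁ t₂ => intro s; rw [subst_consSeq_up]; exact Beta.beta _ _
  | appL t₂ _ ih => intro s; exact Beta.appL _ (ih s)
  | appR t₁ _ ih => intro s; exact Beta.appR _ (ih s)
  | lam _ ih => intro s; exact Beta.lam (ih _)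

theorem BetaStar.rename {t t' : DBTerm C V} (h : BetaStar t t') (ρ : ℕ+ → ℕ+) :
    BetaStar (t.rename ρ) (t'.rename ρ) := by
  rw [rename_eq_subst, rename_eq_subst]
  exact h.lift (fun t => t.subst fun i => var (ρ i)) fun _ _ h => h.subst _

theorem BetaStar.subst_right (t : DBTerm C V) :
    ∀ {s s' : ℕ+ → DBTerm C V}, (∀ i, BetaStar (s i) (s' i)) →
      BetaStar (t.subst s) (t.subst s') := by
  induction t with
  | const c => intros; exact .refl
  | mvar v => intros; exact .refl
  | var i => intro s s' h; exact h i
  | app t₁ t₂ h₁ h₂ => intro s s' h; exact (h₁ h).app (h₂ h)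
  | lam t ih =>
    intro s s' h
    refine (ih fun i => ?_).lam
    rcases pnat_cases i with rfl | ⟨j, rfl⟩
    · rw [consSeq_one, consSeq_one]
    · rw [consSeq_add_one, consSeq_add_one]; exact (h j).rename _

theorem BetaStar.subst {t t' : DBTerm C V} (ht : BetaStar t t') {s s' : ℕ+ → DBTerm C V}
    (h : ∀ i, BetaStar (s i) (s' i)) : BetaStar (t.subst s) (t'.subst s') :=
  (ht.lift (fun t => t.subst s) fun _ _ h => h.subst s).trans (BetaStar.subst_right t' h)

/-- `β`-reduction in the components of an environment. -/
abbrev BetaEnv : List (DBTerm C V × ℕ) → List (DBTerm C V × ℕ) → Prop :=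
  List.Forall₂ fun p p' => BetaStar p.1 p'.1 ∧ p.2 = p'.2

theorem BetaEnv.refl (e : List (DBTerm C V × ℕ)) : BetaEnv e e :=
  List.forall₂_same.2 fun _ _ => ⟨.refl, rfl⟩

theorem BetaEnv.envSeq {e e' : List (DBTerm C V × ℕ)} (h : BetaEnv e e') (nl : ℕ) :
    ∀ i, BetaStar (envSeq e nl i) (envSeq e' nl i) := by
  induction h with
  | nil => intro i; exact .refl
  | cons hp _ ih =>
    intro i
    rcases pnat_cases i with rfl | ⟨j, rfl⟩
    · simp only [DBTerm.envSeq, consSeq_one, hp.2]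
      exact hp.1.rename _
    · simpa only [DBTerm.envSeq, consSeq_add_one] using ih j

/-- The branches taken by merging depend only on levels and on the shape of the lists, which
`BetaEnv` fixes; both merges therefore run in parallel. -/
theorem BetaEnv.mergeEnv {e₁ e₁' : List (DBTerm C V × ℕ)} (h₁ : BetaEnv e₁ e₁') :
    ∀ (nl₁ : ℕ) {e₂ e₂' : List (DBTerm C V × ℕ)}, BetaEnv e₂ e₂' →
      BetaEnv (mergeEnv e₁ nl₁ e₂) (mergeEnv e₁' nl₁ e₂') := by
  induction h₁ with
  | nil =>
    intro nl₁ e₂ e₂' h₂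
    induction h₂ generalizing nl₁ with
    | nil => exact BetaEnv.refl _
    | cons hq h₂ ih =>
      rcases nl₁ with _ | n
      · simp only [mergeEnv_nil_zero]; exact .cons hq h₂
      · simp only [mergeEnv_nil_succ]; exact ih n
  | @cons p p' e₁ e₁' hp h₁ ih₁ =>
    intro nl₁ e₂ e₂' h₂
    induction h₂ generalizing nl₁ with
    | nil => simp only [mergeEnv_nil_right]; exact .cons hp h₁
    | @cons q q' e₂ e₂' hq h₂ ih =>
      rw [DBTerm.mergeEnv, DBTerm.mergeEnv]
      by_cases h : p.2 < nl₁
      · rw [if_pos h, if_pos (hp.2 ▸ h)]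
        exact ih _
      · rw [if_neg h, if_neg (hp.2 ▸ h), ← hp.2, ← hq.2, ← h₂.length_eq]
        exact .cons ⟨hp.1.subst (BetaEnv.envSeq (.cons hq h₂) _), rfl⟩ (ih₁ _ (.cons hq h₂))

end DBTerm

/-! ### Values -/

/-- The values of expressions: de Bruijn terms, simple environments of de Bruijn terms, and
their components. -/
def SuspVal (C V : Type*) : SuspSort → Type _
  | .term => DBTerm C V
  | .env => List (DBTerm C V × ℕ)
  | .envTerm => DBTerm C V × ℕ

namespace SuspExp

variable {C V : Type*}

/-- The value of an expression, see `isTheRMNormalForm_embed_denote`. -/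
def denote : {s : SuspSort} → SuspExp C V s → SuspVal C V s
  | _, const c => DBTerm.const c
  | _, mvar v => DBTerm.mvar v
  | _, var i => DBTerm.var i
  | _, app t₁ t₂ => DBTerm.app (denote t₁) (denote t₂)
  | _, lam t => DBTerm.lam (denote t)
  | _, susp t _ nl e => DBTerm.subst (denote t) (DBTerm.envSeq (denote e) nl)
  | _, nil => ([] : List (DBTerm C V × ℕ))
  | _, cons a e => List.cons (α := DBTerm C V × ℕ) (denote a) (denote e)
  | _, merge e₁ nl₁ _ e₂ => DBTerm.mergeEnv (denote e₁) nl₁ (denote e₂)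
  | _, pair t l => ((denote t, l) : DBTerm C V × ℕ)

/-- Simple environments as expressions. -/
def ofEnv : List (DBTerm C V × ℕ) → SuspExp C V .env
  | [] => nil
  | p :: e => cons (pair (ofDB p.1) p.2) (ofEnv e)

/-- Values as expressions. -/
def embed : {s : SuspSort} → SuspVal C V s → SuspExp C V s
  | .term, t => ofDB t
  | .env, e => ofEnv e
  | .envTerm, p => pair (ofDB (Prod.fst p)) (Prod.snd p)

/-! ### Preservation of well-formedness -/

/-- A relation whose steps keep well-formed expressions well-formed, with the same length and with
a level that does not grow (and stays the same for environment terms). -/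
def Preserving (R : ∀ ⦃s : SuspSort⦄, SuspExp C V s → SuspExp C V s → Prop) : Prop :=
  ∀ ⦃s : SuspSort⦄ ⦃x y : SuspExp C V s⦄, R x y → WF x →
    WF y ∧ len y = len x ∧ lev y ≤ lev x ∧ (s = .envTerm → lev y = lev x)

/-- Levels of environments occur in upper bounds only, so they may drop, as they can in m2. The
level of an environment term is itself a bound in `lev e ≤ lev a`, hence must be kept exactly. -/
theorem Preserving.rewrite {R : ∀ ⦃s : SuspSort⦄, SuspExp C V s → SuspExp C V s → Prop}
    (hR : Preserving R) : Preserving fun _ x y => Rewrite R x y := by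
  intro s x y h
  induction h with
  | root h => exact hR h
  | consL e h ih =>
    intro hw
    obtain ⟨h1, h2, h3, h4⟩ := ih hw.1
    have := h4 rfl
    simp_all [WF, len, lev]
  | consR a h ih =>
    intro hw
    obtain ⟨h1, h2, h3, h4⟩ := ih hw.2.1
    simp only [WF, len, lev] at hw ⊢
    exact ⟨⟨hw.1, h1, h3.trans hw.2.2⟩, by rw [h2], le_rfl, fun _ => trivial⟩
  | mergeL nl₁ ol₂ e₂ h ih =>
    intro hw
    obtain ⟨h1, h2, h3, h4⟩ := ih hw.1
    simp only [WF, len, lev] at hw ⊢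
    exact ⟨⟨h1, hw.2.1, hw.2.2.1, h3.trans hw.2.2.2⟩, by rw [h2], le_rfl, fun _ => trivial⟩
  | mergeR e₁ nl₁ ol₂ h ih =>
    intro hw
    obtain ⟨h1, h2, h3, h4⟩ := ih hw.2.1
    simp only [WF, len, lev] at hw ⊢
    exact ⟨⟨hw.1, h1, h2.trans hw.2.2.1, hw.2.2.2⟩, trivial, Nat.add_le_add_right h3 _,
      fun h => by cases h⟩
  | suspR t ol nl h ih =>
    intro hw
    obtain ⟨h1, h2, h3, h4⟩ := ih hw.2.1
    simp only [WF, len, lev] at hw ⊢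
    exact ⟨⟨hw.1, h1, h2.trans hw.2.2.1, h3.trans hw.2.2.2⟩, trivial, le_rfl, fun _ => trivial⟩
  | _ => simp_all [WF, len, lev]

theorem preserving_readRule (μ : MetaInterp) : Preserving (ReadRule (C := C) (V := V) μ) := by
  intro s x y h hw
  cases h <;> simp only [WF, len, lev] at hw ⊢ <;> simp_all <;> omega

theorem preserving_mergeRule : Preserving (MergeRule (C := C) (V := V)) := by
  intro s x y h hw
  cases h <;> simp only [WF, len, lev, reduceCtorEq, false_imp_iff, and_true, true_and] at hw ⊢ <;>
    simp_all <;> omega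

theorem preserving_betaSRule : Preserving (BetaSRule (C := C) (V := V)) := by
  intro s x y h hw
  cases h
  simp_all [WF, len, lev]

theorem preserving_stepRM (μ : MetaInterp) :
    Preserving (C := C) (V := V) fun _ x y => StepRM μ x y := by
  intro s x y h hw
  rcases h with h | h
  exacts [(preserving_readRule μ).rewrite h hw, preserving_mergeRule.rewrite h hw]

theorem Preserving.star {R : ∀ ⦃s : SuspSort⦄, SuspExp C V s → SuspExp C V s → Prop}
    (hR : Preserving R) : Preserving fun s => Relation.ReflTransGen (@R s) := by
  intro s x y h hw
  induction h with
  | refl => exact ⟨hw, rfl, le_rfl, fun _ => rfl⟩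
  | tail _ h ih =>
    obtain ⟨h1, h2, h3, h4⟩ := ih
    obtain ⟨k1, k2, k3, k4⟩ := hR h h1
    exact ⟨k1, k2.trans h2, k3.trans h3, fun hs => (k4 hs).trans (h4 hs)⟩

/-! ### Preservation of the condition on meta variables -/

/-- Meta variables are interpreted logically or do not occur. -/
def MetaOK (μ : MetaInterp) {s : SuspSort} (x : SuspExp C V s) : Prop := μ = .logical ∨ MetaFree x

theorem metaFree_rewrite {R : ∀ ⦃s : SuspSort⦄, SuspExp C V s → SuspExp C V s → Prop}
    (hR : ∀ ⦃s : SuspSort⦄ ⦃x y : SuspExp C V s⦄, R x y → MetaFree x → MetaFree y)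
    {s : SuspSort} {x y : SuspExp C V s} (h : Rewrite R x y) : MetaFree x → MetaFree y := by
  induction h with
  | root h => exact hR h
  | _ => simp_all [MetaFree]

theorem metaFree_stepRM (μ : MetaInterp) {s : SuspSort} {x y : SuspExp C V s}
    (h : StepRM μ x y) : MetaFree x → MetaFree y := by
  rcases h with h | h
  · refine metaFree_rewrite (fun s x y h hw => ?_) h
    cases h <;> simp_all [MetaFree]
  · refine metaFree_rewrite (fun s x y h hw => ?_) h
    cases h <;> simp_all [MetaFree]

theorem metaFree_stepBetaS {s : SuspSort} {x y : SuspExp C V s}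
    (h : StepBetaS x y) : MetaFree x → MetaFree y := by
  refine metaFree_rewrite (fun s x y h hw => ?_) h
  cases h
  simp_all [MetaFree]

theorem MetaOK.star {μ : MetaInterp} {s : SuspSort} {x y : SuspExp C V s}
    (h : Relation.ReflTransGen (StepRM μ) x y) (hx : MetaOK μ x) : MetaOK μ y := by
  induction h with
  | refl => exact hx
  | tail _ h ih => exact ih.imp_right (metaFree_stepRM μ h)

/-! ### Values as expressions -/

theorem len_ofEnv (e : List (DBTerm C V × ℕ)) : len (ofEnv e) = e.length := by
  induction e with
  | nil => rfl
  | cons p e ih => simp only [ofEnv, len, ih, List.length_cons, Nat.add_comm]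

theorem desc_of_wf {e : List (DBTerm C V × ℕ)} {n : ℕ} (h : WF (ofEnv e))
    (hn : lev (ofEnv e) ≤ n) : DBTerm.Desc n e := by
  induction e generalizing n with
  | nil => trivial
  | cons p e ih => exact ⟨hn, ih h.2.1 h.2.2⟩

theorem metaOK_of_mem {μ : MetaInterp} {e : List (DBTerm C V × ℕ)} (h : MetaOK μ (ofEnv e)) :
    ∀ p ∈ e, MetaOK μ (ofDB p.1) := by
  induction e with
  | nil => simp
  | cons q e ih =>
    intro p hp
    rcases List.mem_cons.1 hp with rfl | hp
    exacts [h.imp_right And.left, ih (h.imp_right And.right) p hp]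

theorem not_rewrite_ofDB {R : ∀ ⦃s : SuspSort⦄, SuspExp C V s → SuspExp C V s → Prop}
    (hR : ∀ (t : DBTerm C V) z, ¬ R (ofDB t) z) (t : DBTerm C V) :
    ∀ z, ¬ Rewrite R (ofDB t) z := by
  induction t with
  | const c => intro z h; cases h with | root h => exact hR (.const c) _ h
  | mvar v => intro z h; cases h with | root h => exact hR (.mvar v) _ h
  | var i => intro z h; cases h with | root h => exact hR (.var i) _ h
  | app t₁ t₂ h₁ h₂ =>
    intro z h
    cases h with
    | root h => exact hR (.app t₁ t₂) _ h
    | appL _ h => exact h₁ _ h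
    | appR _ h => exact h₂ _ h
  | lam t ih =>
    intro z h
    cases h with
    | root h => exact hR (.lam t) _ h
    | lam h => exact ih _ h

theorem not_rewrite_embed {R : ∀ ⦃s : SuspSort⦄, SuspExp C V s → SuspExp C V s → Prop}
    (hR : ∀ ⦃s⦄ (x : SuspVal C V s) z, ¬ R (embed x) z) {s : SuspSort} (x : SuspVal C V s) :
    ∀ z, ¬ Rewrite R (embed x) z := by
  have ht := not_rewrite_ofDB fun t => hR (s := .term) t
  have hp : ∀ (p : DBTerm C V × ℕ) z, ¬ Rewrite R (pair (ofDB p.1) p.2) z := by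
    intro p z h
    cases h with
    | root h => exact hR (s := .envTerm) p _ h
    | pair _ h => exact ht _ _ h
  cases s with
  | term => exact ht x
  | envTerm => exact hp x
  | env =>
    have : ∀ (e : List (DBTerm C V × ℕ)) z, ¬ Rewrite R (ofEnv e) z := by
      intro e
      induction e with
      | nil => intro z h; cases h with | root h => exact hR (s := .env) ([] : List _) _ h
      | cons p e ih =>
        intro z h
        cases h with
        | root h => exact hR (s := .env) (p :: e : List _) _ h
        | consL _ h => exact hp _ _ h
        | consR _ h => exact ih _ h
    exact this x

/-- Every reading or merging rule has a suspension or a merge at the root of its left side, and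
`embed` produces neither. -/
theorem not_stepRM_embed (μ : MetaInterp) {s : SuspSort} (x : SuspVal C V s) :
    ∀ z, ¬ StepRM μ (embed x) z := by
  rintro z (h | h)
  · refine not_rewrite_embed (fun s x z h => ?_) x z h
    cases s with
    | term => cases x <;> nomatch h
    | env => cases x <;> nomatch h
    | envTerm => nomatch h
  · refine not_rewrite_embed (fun s x z h => ?_) x z h
    cases s with
    | term => cases x <;> nomatch h
    | env => cases x <;> nomatch h
    | envTerm => nomatch h

/-! ### Congruence for reading and merging -/

/-- The reflexive and transitive closure of `StepRM μ`. -/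
abbrev RMStar (μ : MetaInterp) {s : SuspSort} : SuspExp C V s → SuspExp C V s → Prop :=
  Relation.ReflTransGen (StepRM μ)

variable {μ : MetaInterp}

theorem RMStar.read {s : SuspSort} {x y : SuspExp C V s} (h : ReadRule μ x y) : RMStar μ x y :=
  .single (.inl (.root h))

theorem RMStar.mrg {s : SuspSort} {x y : SuspExp C V s} (h : MergeRule x y) : RMStar μ x y :=
  .single (.inr (.root h))

theorem RMStar.app {t₁ t₁' t₂ t₂' : SuspExp C V .term} (h₁ : RMStar μ t₁ t₁')
    (h₂ : RMStar μ t₂ t₂') : RMStar μ (app t₁ t₂) (app t₁' t₂') :=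
  (h₁.lift (fun t => SuspExp.app t t₂) fun _ _ h => h.imp (.appL _) (.appL _)).trans
    (h₂.lift (fun t => SuspExp.app t₁' t) fun _ _ h => h.imp (.appR _) (.appR _))

theorem RMStar.lam {t t' : SuspExp C V .term} (h : RMStar μ t t') : RMStar μ (lam t) (lam t') :=
  h.lift (fun t => SuspExp.lam t) fun _ _ h => h.imp .lam .lam

theorem RMStar.susp {t t' : SuspExp C V .term} {e e' : SuspExp C V .env} (h₁ : RMStar μ t t')
    (h₂ : RMStar μ e e') (ol nl : ℕ) : RMStar μ (susp t ol nl e) (susp t' ol nl e') :=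
  (h₁.lift (fun t => SuspExp.susp t ol nl e) fun _ _ h => h.imp (.suspL _ _ _) (.suspL _ _ _)).trans
    (h₂.lift (fun e => SuspExp.susp t' ol nl e) fun _ _ h => h.imp (.suspR _ _ _) (.suspR _ _ _))

theorem RMStar.cons {a a' : SuspExp C V .envTerm} {e e' : SuspExp C V .env} (h₁ : RMStar μ a a')
    (h₂ : RMStar μ e e') : RMStar μ (cons a e) (cons a' e') :=
  (h₁.lift (fun a => SuspExp.cons a e) fun _ _ h => h.imp (.consL _) (.consL _)).trans
    (h₂.lift (fun e => SuspExp.cons a' e) fun _ _ h => h.imp (.consR _) (.consR _))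

theorem RMStar.merge {e₁ e₁' e₂ e₂' : SuspExp C V .env} (h₁ : RMStar μ e₁ e₁')
    (h₂ : RMStar μ e₂ e₂') (nl₁ ol₂ : ℕ) :
    RMStar μ (merge e₁ nl₁ ol₂ e₂) (merge e₁' nl₁ ol₂ e₂') :=
  (h₁.lift (fun e => SuspExp.merge e nl₁ ol₂ e₂) fun _ _ h =>
    h.imp (.mergeL _ _ _) (.mergeL _ _ _)).trans
    (h₂.lift (fun e => SuspExp.merge e₁' nl₁ ol₂ e) fun _ _ h =>
      h.imp (.mergeR _ _ _) (.mergeR _ _ _))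

theorem RMStar.pair {t t' : SuspExp C V .term} (h : RMStar μ t t') (l : ℕ) :
    RMStar μ (pair t l) (pair t' l) :=
  h.lift (fun t => SuspExp.pair t l) fun _ _ h => h.imp (.pair l) (.pair l)

/-! ### Normalization -/

open DBTerm (envSeq mergeEnv shift Desc)

theorem rmStar_susp_var (i : ℕ+) (e : List (DBTerm C V × ℕ)) (nl : ℕ)
    (he : ∀ p ∈ e, ∀ k, RMStar μ (susp (ofDB p.1) 0 k nil) (ofDB (shift k p.1))) :
    RMStar μ (susp (var i) e.length nl (ofEnv e)) (ofDB (envSeq e nl i)) := by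
  induction e generalizing i with
  | nil => exact .read (.r2 _ _ _ rfl)
  | cons p e ih =>
    rcases DBTerm.pnat_cases i with rfl | ⟨j, rfl⟩
    · refine (RMStar.read (.r3 _ _ _ _ _)).trans ?_
      rw [envSeq, DBTerm.consSeq_one]
      exact he p (by simp) _
    · refine (RMStar.read (.r4 _ _ _ _ _ _ (PNat.lt_add_left 1 j))).trans ?_
      have hj : j + 1 - 1 = j := PNat.eq (by simp)
      rw [envSeq, DBTerm.consSeq_add_one, hj]
      exact ih j fun q hq => he q (by simp [hq])

/-- Rule r3 leaves a shift of an environment entry, itself a suspension to be normalized. Assuming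
`he` for the entries breaks the circle: for the empty environment it is vacuous and yields
`rmStar_susp_shift`, which then supplies `he` in general. Abstractions add only `#1`, shifted by r2.
-/
theorem rmStar_susp_ofDB_of_shift (t : DBTerm C V) (ht : MetaOK μ (ofDB t))
    (e : List (DBTerm C V × ℕ)) (nl : ℕ) (hnl : ∀ p ∈ e, p.2 ≤ nl)
    (he : ∀ p ∈ e, ∀ k, RMStar μ (susp (ofDB p.1) 0 k nil) (ofDB (shift k p.1))) :
    RMStar μ (susp (ofDB t) e.length nl (ofEnv e)) (ofDB (t.subst (envSeq e nl))) := by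
  induction t generalizing e nl with
  | const c => exact .read (.r1 _ _ _ _)
  -- `MetaFree` is false for a meta variable, so the interpretation must be logical.
  | mvar v => exact .read (.r7 (ht.resolve_right id) _ _ _ _)
  | var i => exact rmStar_susp_var i e nl he
  | app t₁ t₂ h₁ h₂ =>
    exact (RMStar.read (.r5 _ _ _ _ _)).trans
      ((h₁ (ht.imp_right And.left) e nl hnl he).app (h₂ (ht.imp_right And.right) e nl hnl he))
  | lam t ih =>
    refine (RMStar.read (.r6 _ _ _ _)).trans ?_
    rw [DBTerm.subst_lam_up, ← DBTerm.envSeq_lift hnl]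
    refine RMStar.lam (ih ht ((.var 1, nl + 1) :: e) (nl + 1) ?_ ?_)
    · intro p hp
      rcases List.mem_cons.1 hp with rfl | hp
      exacts [le_rfl, (hnl p hp).trans (Nat.le_succ nl)]
    · intro p hp k
      rcases List.mem_cons.1 hp with rfl | hp
      exacts [.read (.r2 _ _ _ rfl), he p hp k]

theorem rmStar_susp_shift (t : DBTerm C V) (ht : MetaOK μ (ofDB t)) (k : ℕ) :
    RMStar μ (susp (ofDB t) 0 k nil) (ofDB (shift k t)) := by
  have := rmStar_susp_ofDB_of_shift t ht [] k (by simp) (by simp)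
  rwa [envSeq, ← DBTerm.rename_eq_subst] at this

theorem rmStar_susp_ofDB (t : DBTerm C V) (ht : MetaOK μ (ofDB t))
    (e : List (DBTerm C V × ℕ)) (nl : ℕ) (hnl : ∀ p ∈ e, p.2 ≤ nl)
    (he : ∀ p ∈ e, MetaOK μ (ofDB p.1)) :
    RMStar μ (susp (ofDB t) e.length nl (ofEnv e)) (ofDB (t.subst (envSeq e nl))) :=
  rmStar_susp_ofDB_of_shift t ht e nl hnl fun p hp k => rmStar_susp_shift p.1 (he p hp) k

theorem rmStar_merge_ofEnv (e₁ : List (DBTerm C V × ℕ)) (nl₁ : ℕ) (e₂ : List (DBTerm C V × ℕ))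
    (m : ℕ) (h₁ : Desc nl₁ e₁) (h₂ : Desc m e₂) (k₁ : ∀ p ∈ e₁, MetaOK μ (ofDB p.1))
    (k₂ : ∀ p ∈ e₂, MetaOK μ (ofDB p.1)) :
    RMStar μ (merge (ofEnv e₁) nl₁ e₂.length (ofEnv e₂)) (ofEnv (mergeEnv e₁ nl₁ e₂)) := by
  induction e₁ generalizing nl₁ e₂ m with
  | nil =>
    induction e₂ generalizing nl₁ m with
    | nil => rw [DBTerm.mergeEnv_nil_right]; exact .mrg (.m2 _ _)
    | cons q e₂ ih =>
      rcases nl₁ with _ | n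
      · rw [DBTerm.mergeEnv_nil_zero]; exact .mrg (.m3 _ _)
      · rw [DBTerm.mergeEnv_nil_succ]
        exact (RMStar.mrg (.m4 _ _ _ _ _ (Nat.succ_pos n))).trans
          (ih n _ trivial h₂.2 fun p hp => k₂ p (by simp [hp]))
  | cons p e₁ ih₁ =>
    induction e₂ generalizing nl₁ m with
    | nil => rw [DBTerm.mergeEnv_nil_right]; exact .mrg (.m2 _ _)
    | cons q e₂ ih =>
      rcases h₁.1.eq_or_lt with h | h
      · subst h
        rw [DBTerm.mergeEnv_cons_self]
        refine (RMStar.mrg (.m6 _ _ _ _ _ _ _)).trans (RMStar.cons (RMStar.pair ?_ _) ?_)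
        · exact rmStar_susp_ofDB p.1 (k₁ p (by simp)) (q :: e₂) q.2
            (Desc.le ⟨le_rfl, h₂.2⟩) k₂
        · exact ih₁ p.2 (q :: e₂) m h₁.2 h₂ (fun p hp => k₁ p (by simp [hp])) k₂
      · obtain ⟨n, rfl⟩ := Nat.exists_eq_succ_of_ne_zero (Nat.ne_of_gt (Nat.zero_lt_of_lt h))
        have hn : p.2 ≤ n := Nat.le_of_lt_succ h
        rw [DBTerm.mergeEnv_cons_succ _ _ _ _ _ hn]
        exact (RMStar.mrg (.m5 _ _ _ _ _ _ _ _ h)).trans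
          (ih n _ ⟨hn, h₁.2⟩ h₂.2 fun p hp => k₂ p (by simp [hp]))

theorem wf_embed_of_rmStar {s : SuspSort} {x y : SuspExp C V s} (hw : WF x) (h : RMStar μ x y) :
    WF y ∧ len y = len x ∧ lev y ≤ lev x :=
  have := (preserving_stepRM μ).star h hw
  ⟨this.1, this.2.1, this.2.2.1⟩

/-- Every well-formed expression reduces to its value. -/
theorem rmStar_embed_denote {s : SuspSort} (x : SuspExp C V s) (hw : WF x) (hx : MetaOK μ x) :
    RMStar μ x (embed (denote x)) := by
  induction x with
  | const c => exact .refl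
  | mvar v => exact .refl
  | var i => exact .refl
  | nil => exact .refl
  | app t₁ t₂ h₁ h₂ =>
    exact (h₁ hw.1 (hx.imp_right And.left)).app (h₂ hw.2 (hx.imp_right And.right))
  | lam t ih => exact (ih hw hx).lam
  | pair t l ih => exact (ih hw hx).pair l
  | cons a e h₁ h₂ =>
    exact (h₁ hw.1 (hx.imp_right And.left)).cons (h₂ hw.2.1 (hx.imp_right And.right))
  | susp t ol nl e h₁ h₂ =>
    have s₁ := h₁ hw.1 (hx.imp_right And.left)
    have s₂ := h₂ hw.2.1 (hx.imp_right And.right)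
    obtain ⟨w₁, w₂, w₃⟩ := wf_embed_of_rmStar hw.2.1 s₂
    -- Reduction preserves length, so the annotation still counts the entries of the value.
    have hol : ol = List.length (α := DBTerm C V × ℕ) (denote e) := by
      rw [← hw.2.2.1, ← w₂]; exact len_ofEnv _
    refine (s₁.susp s₂ ol nl).trans ?_
    rw [hol]
    exact rmStar_susp_ofDB (denote t) (.star s₁ (hx.imp_right And.left)) (denote e) nl
      (desc_of_wf w₁ (w₃.trans hw.2.2.2)).le
      (metaOK_of_mem (.star s₂ (hx.imp_right And.right)))
  | merge e₁ nl₁ ol₂ e₂ h₁ h₂ =>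
    have s₁ := h₁ hw.1 (hx.imp_right And.left)
    have s₂ := h₂ hw.2.1 (hx.imp_right And.right)
    obtain ⟨v₁, v₂, v₃⟩ := wf_embed_of_rmStar hw.1 s₁
    obtain ⟨w₁, w₂, w₃⟩ := wf_embed_of_rmStar hw.2.1 s₂
    have hol : ol₂ = List.length (α := DBTerm C V × ℕ) (denote e₂) := by
      rw [← hw.2.2.1, ← w₂]; exact len_ofEnv _
    refine (s₁.merge s₂ nl₁ ol₂).trans ?_
    rw [hol]
    exact rmStar_merge_ofEnv (denote e₁) nl₁ (denote e₂) _
      (desc_of_wf v₁ (v₃.trans hw.2.2.2)) (desc_of_wf w₁ le_rfl)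
      (metaOK_of_mem (.star s₁ (hx.imp_right And.left)))
      (metaOK_of_mem (.star s₂ (hx.imp_right And.right)))

end SuspExp

namespace SuspExp

variable {C V : Type*} {μ : MetaInterp}

open DBTerm (envSeq mergeEnv shift Desc)

/-! ### Invariance of the value -/

/-- Length and level bounds of the value are not computed but carried along the reduction to it. -/
theorem denote_env {e : SuspExp C V .env} (hw : WF e) (he : MetaOK μ e) :
    List.length (α := DBTerm C V × ℕ) (denote e) = len e ∧
      ∀ n, lev e ≤ n → Desc n (denote e : List (DBTerm C V × ℕ)) := by
  obtain ⟨w₁, w₂, w₃⟩ := wf_embed_of_rmStar hw (rmStar_embed_denote e hw he)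
  exact ⟨(len_ofEnv _).symm.trans w₂, fun n hn => desc_of_wf w₁ (w₃.trans hn)⟩

theorem denote_readRule {s : SuspSort} {x y : SuspExp C V s} (h : ReadRule μ x y) (hw : WF x)
    (hx : MetaOK μ x) : denote x = denote y := by
  cases h with
  | r1 => rfl
  | r2 i j nl hj => exact congrArg DBTerm.var (PNat.eq hj.symm)
  | r3 ol nl t l e =>
    refine Eq.trans ?_ (DBTerm.rename_eq_subst (denote t) _)
    exact DBTerm.consSeq_one _ (envSeq (denote e) nl)
  | r4 i ol nl t l e hi =>
    rcases DBTerm.pnat_cases i with rfl | ⟨j, rfl⟩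
    · exact absurd hi (lt_irrefl _)
    · have hj : j + 1 - 1 = j := PNat.eq (by simp)
      rw [hj]
      exact DBTerm.consSeq_add_one _ (envSeq (denote e) nl) _
  | r5 => rfl
  | r6 t ol nl e =>
    have := (denote_env hw.2.1 (hx.imp_right And.right)).2 nl hw.2.2.2
    exact congrArg (fun s => DBTerm.lam (DBTerm.subst (denote t) s))
      (DBTerm.envSeq_lift this.le).symm
  | r7 => rfl

theorem denote_mergeRule {s : SuspSort} {x y : SuspExp C V s} (h : MergeRule x y) (hw : WF x)
    (hx : MetaOK μ x) : denote x = denote y := by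
  cases h with
  | m1 t ol₁ nl₁ e₁ ol₂ nl₂ e₂ =>
    have d₁ := denote_env hw.1.2.1 (hx.imp_right fun h => h.1.2)
    have d₂ := denote_env hw.2.1 (hx.imp_right And.right)
    have := DBTerm.envSeq_mergeEnv (denote e₁) nl₁ (denote e₂) nl₂ (d₁.2 _ hw.1.2.2.2)
      (d₂.2 _ hw.2.2.2)
    -- `denote` ignores the first annotation of a suspension; the second one matters, and
    -- well-formedness turns the length in it into `ol₂`.
    rw [d₂.1, hw.2.2.1] at this
    refine (DBTerm.subst_subst (denote t) _ _).trans ?_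
    exact congrArg (DBTerm.subst (denote t)) this.symm
  | m2 e₁ nl₁ => exact DBTerm.mergeEnv_nil_right _ _
  | m3 ol₂ e₂ => exact DBTerm.mergeEnv_nil_zero _
  | m4 nl₁ ol₂ t l e₂ h =>
    obtain ⟨n, rfl⟩ := Nat.exists_eq_succ_of_ne_zero (Nat.ne_of_gt h)
    exact DBTerm.mergeEnv_nil_succ _ _ _
  | m5 t n e₁ nl₁ ol₂ u l e₂ h =>
    obtain ⟨k, rfl⟩ := Nat.exists_eq_succ_of_ne_zero (Nat.ne_of_gt (Nat.zero_lt_of_lt h))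
    exact DBTerm.mergeEnv_cons_succ _ _ _ _ _ (Nat.le_of_lt_succ h)
  | m6 t n e₁ ol₂ u l e₂ =>
    have d₂ := denote_env hw.2.1.2.1 (hx.imp_right fun h => h.2.2)
    have hol : ol₂ = List.length (α := DBTerm C V × ℕ) (denote e₂) + 1 := by
      rw [d₂.1, ← hw.2.2.1, len, Nat.add_comm]
    rw [hol]
    exact DBTerm.mergeEnv_cons_self (denote (pair t n)) (denote e₁) (denote (pair u l)) (denote e₂)

theorem denote_rewrite {R : ∀ ⦃s : SuspSort⦄, SuspExp C V s → SuspExp C V s → Prop}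
    (hR : ∀ ⦃s : SuspSort⦄ ⦃x y : SuspExp C V s⦄, R x y → WF x → MetaOK μ x → denote x = denote y)
    {s : SuspSort} {x y : SuspExp C V s} (h : Rewrite R x y) (hw : WF x) (hx : MetaOK μ x) :
    denote x = denote y := by
  induction h with
  | root h => exact hR h hw hx
  | appL _ _ ih => simp only [denote, ih hw.1 (hx.imp_right And.left)]; rfl
  | appR _ _ ih => simp only [denote, ih hw.2 (hx.imp_right And.right)]; rfl
  | lam _ ih => simp only [denote, ih hw hx]; rfl
  | suspL _ _ _ _ ih => simp only [denote, ih hw.1 (hx.imp_right And.left)]; rfl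
  | suspR _ _ _ _ ih => simp only [denote, ih hw.2.1 (hx.imp_right And.right)]; rfl
  | consL _ _ ih => simp only [denote, ih hw.1 (hx.imp_right And.left)]; rfl
  | consR _ _ ih => simp only [denote, ih hw.2.1 (hx.imp_right And.right)]; rfl
  | mergeL _ _ _ _ ih => simp only [denote, ih hw.1 (hx.imp_right And.left)]; rfl
  | mergeR _ _ _ _ ih => simp only [denote, ih hw.2.1 (hx.imp_right And.right)]; rfl
  | pair _ _ ih => simp only [denote, ih hw hx]; rfl

theorem denote_stepRM {s : SuspSort} {x y : SuspExp C V s} (h : StepRM μ x y) (hw : WF x)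
    (hx : MetaOK μ x) : denote x = denote y := by
  rcases h with h | h
  · exact denote_rewrite (fun _ _ _ => denote_readRule) h hw hx
  · exact denote_rewrite (fun _ _ _ => denote_mergeRule) h hw hx

theorem denote_rmStar {s : SuspSort} {x y : SuspExp C V s} (h : RMStar μ x y) (hw : WF x)
    (hx : MetaOK μ x) : denote x = denote y := by
  induction h with
  | refl => rfl
  | tail h h' ih =>
    exact ih.trans (denote_stepRM h' (wf_embed_of_rmStar hw h).1 (.star h hx))

/-- Another normal form `z` has the same value and reduces to it; being irreducible, `z` already is
that value. -/
theorem isTheRMNormalForm_embed_denote {s : SuspSort} {x : SuspExp C V s} (hw : WF x)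
    (hx : MetaOK μ x) : IsTheRMNormalForm μ x (embed (denote x)) := by
  refine ⟨⟨rmStar_embed_denote x hw hx, not_stepRM_embed μ _⟩, fun z hz => ?_⟩
  have h := rmStar_embed_denote z (wf_embed_of_rmStar hw hz.1).1 (.star hz.1 hx)
  rw [← denote_rmStar hz.1 hw hx] at h
  rcases h.cases_head with h | ⟨w, h, _⟩
  exacts [h, absurd h (hz.2 w)]

/-! ### `β_s`-steps on values -/

theorem stepBeta_ofDB {t t' : DBTerm C V} (h : DBTerm.Beta t t') :
    StepBeta (ofDB t) (ofDB t') := by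
  induction h with
  | beta t₁ t₂ => exact .root (.beta t₁ t₂)
  | appL t₂ _ ih => exact .appL _ ih
  | appR t₁ _ ih => exact .appR _ ih
  | lam _ ih => exact .lam ih

/-- `β`-reduction of values. -/
def BetaVal : {s : SuspSort} → SuspVal C V s → SuspVal C V s → Prop
  | .term, t, t' => DBTerm.BetaStar t t'
  | .env, e, e' => DBTerm.BetaEnv e e'
  | .envTerm, p, p' => DBTerm.BetaStar (Prod.fst p) (Prod.fst p') ∧ Prod.snd p = Prod.snd p'

theorem stepBeta_pair {p p' : DBTerm C V × ℕ} (h : DBTerm.BetaStar p.1 p'.1 ∧ p.2 = p'.2) :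
    Relation.ReflTransGen StepBeta (pair (ofDB p.1) p.2) (pair (ofDB p'.1) p'.2) := by
  rw [← h.2]
  exact h.1.lift (fun t => pair (ofDB t) p.2) fun _ _ h => .pair _ (stepBeta_ofDB h)

theorem stepBeta_embed {s : SuspSort} {x y : SuspVal C V s} (h : BetaVal x y) :
    Relation.ReflTransGen StepBeta (embed x) (embed y) := by
  cases s with
  | term => exact Relation.ReflTransGen.lift ofDB (fun _ _ => stepBeta_ofDB) _ _ h
  | envTerm => exact stepBeta_pair h
  | env =>
    have : ∀ {e e' : List (DBTerm C V × ℕ)}, DBTerm.BetaEnv e e' →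
        Relation.ReflTransGen StepBeta (ofEnv e) (ofEnv e') := by
      intro e e' h
      induction h with
      | nil => exact .refl
      | @cons p p' e e' hp _ ih =>
        exact ((stepBeta_pair hp).lift (fun a => cons a (ofEnv e)) fun _ _ h => .consL _ h).trans
          (ih.lift (fun e => cons (pair (ofDB p'.1) p'.2) e) fun _ _ h => .consR _ h)
    exact this h

theorem BetaVal.refl {s : SuspSort} (x : SuspVal C V s) : BetaVal x x := by
  cases s with
  | term => exact Relation.ReflTransGen.refl
  | env => exact DBTerm.BetaEnv.refl x
  | envTerm => exact ⟨Relation.ReflTransGen.refl, rfl⟩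

/-- Contraction happens only at the root case; the other cases are monotonicity of the operations on
values. -/
theorem denote_stepBetaS {s : SuspSort} {x y : SuspExp C V s} (h : StepBetaS x y) :
    BetaVal (denote x) (denote y) := by
  induction h with
  | root h =>
    cases h with
    | betaS t₁ t₂ =>
      exact .single (DBTerm.beta_envSeq (denote t₁) (denote t₂))
  | appL t₂ _ ih => exact DBTerm.BetaStar.app ih .refl
  | appR t₁ _ ih => exact DBTerm.BetaStar.app .refl ih
  | lam _ ih => exact DBTerm.BetaStar.lam ih
  | suspL ol nl e _ ih => exact DBTerm.BetaStar.subst ih fun _ => .refl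
  | suspR t ol nl _ ih => exact DBTerm.BetaStar.subst .refl (DBTerm.BetaEnv.envSeq ih nl)
  | consL e _ ih => exact .cons ih (DBTerm.BetaEnv.refl _)
  | consR a _ ih => exact .cons ⟨.refl, rfl⟩ ih
  | mergeL nl₁ ol₂ e₂ _ ih => exact DBTerm.BetaEnv.mergeEnv ih nl₁ (DBTerm.BetaEnv.refl _)
  | mergeR e₁ nl₁ ol₂ _ ih => exact DBTerm.BetaEnv.mergeEnv (DBTerm.BetaEnv.refl _) nl₁ ih
  | pair l _ ih => exact ⟨ih, rfl⟩

end SuspExp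

theorem mainTheorem5 {C V : Type*} (μ : MetaInterp) {s : SuspSort} (x₁ x₂ : SuspExp C V s)
    (hwf : x₁.WF) (hμ : μ = MetaInterp.logical ∨ x₁.MetaFree) (hstep : StepBetaS x₁ x₂) :
    ∃ y₁ y₂ : SuspExp C V s,
      IsTheRMNormalForm μ x₁ y₁ ∧ IsTheRMNormalForm μ x₂ y₂ ∧
        Relation.ReflTransGen StepBeta y₁ y₂ :=
  have hwf₂ := (SuspExp.preserving_betaSRule.rewrite hstep hwf).1
  ⟨_, _, SuspExp.isTheRMNormalForm_embed_denote hwf hμ,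
    SuspExp.isTheRMNormalForm_embed_denote hwf₂ (hμ.imp_right (SuspExp.metaFree_stepBetaS hstep)),
    SuspExp.stepBeta_embed (SuspExp.denote_stepBetaS hstep)⟩
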